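/- For convex bodies (nonempty compact convex sets) $K,E\subset\mathbb R^n$ let $W_0(K;E),\dots,W_n(K;E)$ be the relative quermassintegrals, i.e. the unique real numbers with $$V(K+\rho E)=\sum_{i=0}^n\binom ni W_i(K;E)\,\rho^i\qquad\text{for all }\rho\ge 0,$$ where $V$ is $n$-dimensional Lebesgue measure. Let $$f(K,E,s)=\sum_{i=0}^n\binom ni W_i(K;E)\,s^i\in\mathbb C[s]$$ be the relative Steiner polynomial, and let $r(K;E)=\max\{r:\exists\,x\in\mathbb R^n,\ x+rE\subseteq K\}$ be the relative inradius. Let $B_3$ be the closed unit ball of $\mathbb R^3$. There is a convex body $K\subset\mathbb R^3$ with nonempty interior such that every complex root $s$ of $f(B_3,K,s)$ satisfies $\operatorname{Re}(s)<-r(B_3;K)$. More precisely, one can take $K=L_1=L+B_3$, where $L$ is the planar symmetric lens of circumradius $1$ and perimeter $p=5.2$: for some $\varphi\in(0,\pi/2)$ with $5.2\sin\varphi=4\varphi$, $L$ is the set of points of the plane $x_3=0$ that have distance at most $1/\sin\varphi$ from both of the points $(0,\pm\cot\varphi,0)$. With $A=p\,(p-4\cos\varphi)/(8\varphi)$, the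 area of $L$, one has $$f(B_3,L_1,s)=\Bigl(2A+\tfrac{\pi}{2}p+\tfrac43\pi\Bigr)s^3+\bigl(2A+\pi p+4\pi\bigr)s^2+\Bigl(\tfrac{\pi}{2}p+4\pi\Bigr)s+\tfrac43\pi .$$ The roots of this cubic, with multiplicity, are $-1$, $z$ and $\bar z$ for some $z\in\mathbb C$ with $|\operatorname{Re}z+0.503393|<10^{-6}$ and $|\operatorname{Im}z-0.038442|<10^{-6}$. Moreover $r(B_3;L_1)=1/2$. -/

import Mathlib

open Polynomial
open scoped Pointwise

noncomputable section

/-- Euclidean `n`-space with its Euclidean norm and Lebesgue measure. -/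
abbrev Euc (n : ℕ) : Type := EuclideanSpace ℝ (Fin n)

/-- The closed Euclidean unit ball `B_n` as a convex body. -/
def unitBall (n : ℕ) : ConvexBody (Euc n) where
  carrier := Metric.closedBall 0 1
  convex' := convex_closedBall 0 1
  isCompact' := isCompact_closedBall 0 1
  nonempty' := ⟨0, Metric.mem_closedBall_self zero_le_one⟩

/-- `W 0, …, W n` are the relative quermassintegrals `W_i(K; E)`: for every `ρ ≥ 0` the volume of
`K + ρ E` equals `∑ i, (n choose i) * W i * ρ ^ i`. -/
def IsRelQuermassintegrals {n : ℕ} (K E : ConvexBody (Euc n)) (W : Fin (n + 1) → ℝ) : Prop :=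
  ∀ ρ : ℝ, 0 ≤ ρ →
    MeasureTheory.volume.real ((K + ρ • E : ConvexBody (Euc n)) : Set (Euc n)) =
      ∑ i : Fin (n + 1), (n.choose i : ℝ) * W i * ρ ^ (i : ℕ)

/-- The polynomial `∑ i, (n choose i) * W i * s ^ i` in a complex variable `s`. If `W` are the
relative quermassintegrals of `K` with respect to `E`, this is the relative Steiner polynomial
`f(K, E, s)`. -/
def steinerPolynomial {n : ℕ} (W : Fin (n + 1) → ℝ) : ℂ[X] :=
  ∑ i : Fin (n + 1), C (((n.choose i : ℝ) * W i : ℝ) : ℂ) * X ^ (i : ℕ)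

/-- The relative quermassintegrals are determined by the two bodies. -/
theorem IsRelQuermassintegrals.unique {n : ℕ} {K E : ConvexBody (Euc n)}
    {W W' : Fin (n + 1) → ℝ} (h : IsRelQuermassintegrals K E W)
    (h' : IsRelQuermassintegrals K E W') : W = W' := by
  let p : (Fin (n + 1) → ℝ) → ℝ[X] := fun V =>
    ∑ i : Fin (n + 1), C ((n.choose i : ℝ) * V i) * X ^ (i : ℕ)
  have hp : p W = p W' := by
    apply Polynomial.eq_of_infinite_eval_eq
    refine (Set.Ici_infinite (0 : ℝ)).mono fun ρ hρ => ?_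
    have e := (h ρ hρ).symm.trans (h' ρ hρ)
    simpa [p, Polynomial.eval_finsetSum] using e
  have hc : ∀ (V : Fin (n + 1) → ℝ) (i : Fin (n + 1)),
      (p V).coeff (i : ℕ) = (n.choose i : ℝ) * V i := by
    intro V i
    simp only [p, Polynomial.finsetSum_coeff, Polynomial.coeff_C_mul, Polynomial.coeff_X_pow]
    rw [Finset.sum_eq_single i]
    · simp
    · intro j _ hj
      simp [Fin.val_inj, hj.symm]
    · simp
  funext i
  have e := hc W i
  rw [hp, hc W' i] at e
  have hpos : (n.choose i : ℝ) ≠ 0 := by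
    exact_mod_cast (Nat.choose_pos (Nat.lt_succ_iff.mp i.isLt)).ne'
  exact (mul_left_cancel₀ hpos e).symm

/-- `r` is the relative inradius `r(K; E) = max {r : ∃ x, x + r E ⊆ K}`. -/
def IsRelInradius {n : ℕ} (K E : ConvexBody (Euc n)) (r : ℝ) : Prop :=
  IsGreatest {t : ℝ | ∃ x : Euc n, x +ᵥ (t • (E : Set (Euc n))) ⊆ (K : Set (Euc n))} r

/-- The symmetric lens of circumradius `1` and half angle `φ` in the plane `x 2 = 0` of
three-space: the intersection of the two discs of radius `1 / sin φ` whose boundary circles pass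
through `(1, 0, 0)` and `(-1, 0, 0)`. Its boundary consists of two arcs of radius `1 / sin φ`
and angle `2 φ`, so its perimeter is `4 φ / sin φ`. -/
def symmetricLens (φ : ℝ) : Set (Euc 3) :=
  {x | x 2 = 0 ∧
    x ∈ Metric.closedBall (!₂[0, Real.cos φ / Real.sin φ, 0] : Euc 3) (1 / Real.sin φ) ∧
    x ∈ Metric.closedBall (!₂[0, -(Real.cos φ / Real.sin φ), 0] : Euc 3) (1 / Real.sin φ)}

/-- The area of a symmetric lens of circumradius `1`, half angle `φ` and perimeter `p`. -/
def lensArea (p φ : ℝ) : ℝ := p * (p - 4 * Real.cos φ) / (8 * φ)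

/-- The cubic `(2Aν + (π/2)pν² + (4/3)πν³) s³ + (2A + πpν + 4πν²) s² + ((π/2)p + 4πν) s + (4/3)π`
at `ν = 1`. -/
def lensCubic (A p : ℝ) : ℂ[X] :=
  C ((2 * A + Real.pi / 2 * p + 4 / 3 * Real.pi : ℝ) : ℂ) * X ^ 3 +
  C ((2 * A + Real.pi * p + 4 * Real.pi : ℝ) : ℂ) * X ^ 2 +
  C ((Real.pi / 2 * p + 4 * Real.pi : ℝ) : ℂ) * X +
  C ((4 / 3 * Real.pi : ℝ) : ℂ)

end

noncomputable section

open MeasureTheory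

/-! For ρ > 0, B + ρ(L + B) is ρ(L + (1/ρ + 1)B), so everything follows from the volume of L + tB. A
horizontal slice of L + tB at height z, |z| ≤ t, is the planar parallel body of L at distance s =
√(t² - z²). Its area A + Ps + πs² (`exists_lens_dist_le_iff`, `lintegral_lensHalfChord_abs`)
integrates to 2At + (π/2)Pt² + (4/3)πt³ (`volume_symmetricLens_add_closedBall`).

Since L is flat there is no constant term in t, so after rescaling every term carries a factor 1 +
ρ. Hence -1 is a root and the cubic is (s + 1)(as² + bs + c), with a = 2A + (π/2)p + (4/3)π, b =
(π/2)p + (8/3)π, c = (4/3)π (`roots_lensCubic`). A non-real root z has Re z = -b/(2a), which is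
below -1/2 exactly when a < b, that is, A < 2π/3 ≈ 2.094. For p = 5.2 the area is about 2.0386 and
the discriminant is negative (`lensArea_bounds`, `steiner_quadratic_bounds`).

The inradius is 1/2 because L + B lies in the ball of radius 2 and contains the antipodal points
(±2, 0, 0) (`isRelInradius_lensBody`). -/

/-! ### Plane geometry: parallel bodies of the lens -/

theorem sum_sq_add_le_sq_add {a b u v R s : ℝ} (hR : 0 ≤ R) (hs : 0 ≤ s)
    (h₁ : a ^ 2 + b ^ 2 ≤ R ^ 2) (h₂ : u ^ 2 + v ^ 2 ≤ s ^ 2) :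
    (a + u) ^ 2 + (b + v) ^ 2 ≤ (R + s) ^ 2 := by
  have h : a * u + b * v ≤ R * s := by
    refine abs_le_of_sq_le_sq' ?_ (by positivity) |>.2
    calc (a * u + b * v) ^ 2 ≤ (a ^ 2 + b ^ 2) * (u ^ 2 + v ^ 2) := by
          nlinarith [sq_nonneg (a * v - b * u)]
      _ ≤ R ^ 2 * s ^ 2 := by gcongr
      _ = (R * s) ^ 2 := by ring
  nlinarith

/-- The inequality `S a + k b ≤ R` for points `(a, b)` of the disc of radius `R`, for a unit
vector `(S, k)`. -/
theorem linear_le_of_sq_add_sq_le {a b S k R : ℝ} (hR : 0 ≤ R) (h : a ^ 2 + b ^ 2 ≤ R ^ 2)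
    (hSk : S ^ 2 + k ^ 2 = 1) : S * a + k * b ≤ R := by
  refine abs_le_of_sq_le_sq' ?_ hR |>.2
  nlinarith [sq_nonneg (S * b - k * a)]

section Planar

variable {S k R s x y : ℝ}

/-- In the first quadrant: a point within distance `s` of the lens lies in the enlarged disc, and
beyond the line `x = 1 + s S` it is within distance `s` of the vertex `(1, 0)`. -/
theorem lens_parallel_forward (hS : 0 < S) (hk : 0 < k) (hSk : S ^ 2 + k ^ 2 = 1) (hRS : R * S = 1)
    (hs : 0 ≤ s) (hy : 0 ≤ y) {a b : ℝ}
    (h₁ : a ^ 2 + (b - R * k) ^ 2 ≤ R ^ 2) (h₂ : a ^ 2 + (b + R * k) ^ 2 ≤ R ^ 2)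
    (h : (x - a) ^ 2 + (y - b) ^ 2 ≤ s ^ 2) :
    x ^ 2 + (y + R * k) ^ 2 ≤ (R + s) ^ 2 ∧ (1 + s * S < x → (x - 1) ^ 2 + y ^ 2 ≤ s ^ 2) := by
  have hR : 0 < R := by
    by_contra hR
    nlinarith
  have hdisc : x ^ 2 + (y + R * k) ^ 2 ≤ (R + s) ^ 2 := by
    have := sum_sq_add_le_sq_add hR.le hs h₂ h
    convert this using 3 <;> ring
  refine ⟨hdisc, fun hx => ?_⟩
  -- The point lies in the normal cone of the vertex: otherwise both coordinates, measured from the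
  -- centre (0, -Rk), exceed those of (R + s)(S, k), a point on the enlarged circle.
  have hcone : y * S ≤ (x - 1) * k := by
    by_contra! hlt
    have e₁ : (R + s) * S < x := by nlinarith
    have e₂ : (R + s) * k < y + R * k := by
      have : s * k * S < y * S := by nlinarith
      have := lt_of_mul_lt_mul_right this hS.le
      linarith
    have e₃ : ((R + s) * S) ^ 2 < x ^ 2 := by gcongr
    have e₄ : ((R + s) * k) ^ 2 < (y + R * k) ^ 2 := by gcongr
    nlinarith
  -- The tangents to the two arcs at (1, 0) support the lens.
  have hb₂ : k * b ≤ S * (1 - a) := by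
    have := linear_le_of_sq_add_sq_le hR.le h₂ hSk
    nlinarith
  have hb₁ : -(k * b) ≤ S * (1 - a) := by
    have := linear_le_of_sq_add_sq_le (S := S) (k := -k) hR.le h₁ (by rw [← hSk]; ring)
    nlinarith
  have ha : 0 ≤ 1 - a := by
    by_contra! ha
    nlinarith
  have hd : 0 ≤ x - 1 := by nlinarith
  -- Obtuse angle at the vertex: (x - 1, y) and (1 - a, -b) have nonnegative inner product, so the
  -- vertex is at least as close to (x, y) as (a, b) is.
  have hdot : 0 ≤ (x - 1) * (1 - a) - y * b := by
    rcases le_total b 0 with hb | hb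
    · nlinarith [mul_nonneg hd ha, mul_nonneg hy (neg_nonneg.2 hb)]
    · have : (y * S) * (k * b) ≤ ((x - 1) * k) * (S * (1 - a)) := by gcongr
      have h3 : 0 ≤ (S * k) * ((x - 1) * (1 - a) - y * b) := by linarith
      exact nonneg_of_mul_nonneg_right h3 (by positivity)
  nlinarith [sq_nonneg (1 - a), sq_nonneg b]

/-- The witness is the nearest point of the lens: the point itself if it is inside, the vertex if it
lies in the normal cone there, and otherwise its radial projection to the upper arc. -/
theorem lens_parallel_backward (hS : 0 < S) (hk : 0 < k) (hSk : S ^ 2 + k ^ 2 = 1)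
    (hRS : R * S = 1) (hs : 0 ≤ s) (hx : 0 ≤ x) (hy : 0 ≤ y)
    (h : (x ≤ 1 + s * S ∧ x ^ 2 + (y + R * k) ^ 2 ≤ (R + s) ^ 2) ∨
      (1 + s * S < x ∧ (x - 1) ^ 2 + y ^ 2 ≤ s ^ 2)) :
    ∃ a b : ℝ, a ^ 2 + (b - R * k) ^ 2 ≤ R ^ 2 ∧ a ^ 2 + (b + R * k) ^ 2 ≤ R ^ 2 ∧
      (x - a) ^ 2 + (y - b) ^ 2 ≤ s ^ 2 := by
  have hR : 0 < R := by
    by_contra hR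
    nlinarith
  have hvertex : (1 : ℝ) + (R * k) ^ 2 = R ^ 2 := by
    have : (1 : ℝ) = (R * S) ^ 2 := by rw [hRS]; ring
    linear_combination this + R ^ 2 * hSk
  rcases h with ⟨hx1, hd⟩ | ⟨-, hd⟩
  · rcases le_or_gt (x ^ 2 + (y + R * k) ^ 2) (R ^ 2) with hin | hout
    · exact ⟨x, y, by nlinarith [mul_nonneg hy (mul_pos hR hk).le], hin, by
        simpa using sq_nonneg s⟩
    · rcases lt_or_ge (y * S) ((x - 1) * k) with hc | hc
      · refine ⟨1, 0, by linarith, by linarith, ?_⟩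
        have hx0 : 0 ≤ x - 1 := by
          by_contra! hneg
          nlinarith [mul_nonneg hy hS.le]
        have h1 : (y * S) ^ 2 ≤ ((x - 1) * k) ^ 2 := by gcongr
        have h2 : (x - 1) ^ 2 ≤ (s * S) ^ 2 := by
          gcongr
          linarith
        have h3 : S ^ 2 * ((x - 1) ^ 2 + y ^ 2) ≤ S ^ 2 * s ^ 2 := by nlinarith
        simpa using le_of_mul_le_mul_left h3 (by positivity)
      · set m := √(x ^ 2 + (y + R * k) ^ 2) with hm
        have hmsq : m ^ 2 = x ^ 2 + (y + R * k) ^ 2 := Real.sq_sqrt (by positivity)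
        have hm0 : 0 ≤ m := Real.sqrt_nonneg _
        have hRm : R < m := by
          by_contra! hle
          nlinarith
        have hms : m ≤ R + s := by
          by_contra! hlt
          nlinarith
        have hmpos : 0 < m := hR.trans hRm
        -- Outside the normal cone the direction from (0, -Rk) is at least as steep as (S, k), so
        -- the radial projection stays in the upper half plane and hence in the other disc.
        have hb : m * k ≤ y + R * k := by
          have h1 : x * k ≤ (y + R * k) * S := by nlinarith
          have h2 : (x * k) ^ 2 ≤ ((y + R * k) * S) ^ 2 := by gcongr
          have h3 : (m * k) ^ 2 ≤ (y + R * k) ^ 2 := by nlinarith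
          exact abs_le_of_sq_le_sq' h3 (by positivity) |>.2
        obtain ⟨t, ht0, htm⟩ : ∃ t : ℝ, 0 < t ∧ t * m = R :=
          ⟨R / m, by positivity, div_mul_cancel₀ R hmpos.ne'⟩
        have hnorm : (t * x) ^ 2 + (t * (y + R * k)) ^ 2 = R ^ 2 := by
          linear_combination (-t ^ 2) * hmsq + (t * m + R) * htm
        have hbk : R * k ≤ t * (y + R * k) := by
          calc R * k = t * (m * k) := by rw [← htm]; ring
            _ ≤ t * (y + R * k) := by gcongr
        refine ⟨t * x, t * (y + R * k) - R * k, ?_, ?_, ?_⟩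
        · nlinarith [mul_nonneg (sub_nonneg.2 hbk) (mul_pos hR hk).le]
        · rw [← hnorm]; simp
        · have : (x - t * x) ^ 2 + (y - (t * (y + R * k) - R * k)) ^ 2 = (m - R) ^ 2 := by
            linear_combination (-(1 - t) ^ 2) * hmsq - (2 * m - t * m - R) * htm
          rw [this]
          have : 0 ≤ m - R := by linarith
          gcongr
          linarith
  · exact ⟨1, 0, by linarith, by linarith, by simpa using hd⟩

/-- The points within distance `s` of the planar lens. -/
theorem exists_lens_dist_le_iff (hS : 0 < S) (hk : 0 < k) (hSk : S ^ 2 + k ^ 2 = 1)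
    (hRS : R * S = 1) (hs : 0 ≤ s) :
    (∃ a b : ℝ, a ^ 2 + (b - R * k) ^ 2 ≤ R ^ 2 ∧ a ^ 2 + (b + R * k) ^ 2 ≤ R ^ 2 ∧
      (x - a) ^ 2 + (y - b) ^ 2 ≤ s ^ 2) ↔
    (|x| ≤ 1 + s * S ∧ x ^ 2 + (|y| + R * k) ^ 2 ≤ (R + s) ^ 2) ∨
      (1 + s * S < |x| ∧ (|x| - 1) ^ 2 + y ^ 2 ≤ s ^ 2) := by
  -- The lens is symmetric in both axes, which reduces the claim to the first quadrant.
  have habs : (∃ a b : ℝ, a ^ 2 + (b - R * k) ^ 2 ≤ R ^ 2 ∧ a ^ 2 + (b + R * k) ^ 2 ≤ R ^ 2 ∧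
      (x - a) ^ 2 + (y - b) ^ 2 ≤ s ^ 2) ↔
      (∃ a b : ℝ, a ^ 2 + (b - R * k) ^ 2 ≤ R ^ 2 ∧ a ^ 2 + (b + R * k) ^ 2 ≤ R ^ 2 ∧
      (|x| - a) ^ 2 + (|y| - b) ^ 2 ≤ s ^ 2) := by
    have hx : ∀ x y : ℝ, (∃ a b : ℝ, a ^ 2 + (b - R * k) ^ 2 ≤ R ^ 2 ∧
        a ^ 2 + (b + R * k) ^ 2 ≤ R ^ 2 ∧ (x - a) ^ 2 + (y - b) ^ 2 ≤ s ^ 2) →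
        ∃ a b : ℝ, a ^ 2 + (b - R * k) ^ 2 ≤ R ^ 2 ∧
        a ^ 2 + (b + R * k) ^ 2 ≤ R ^ 2 ∧ (-x - a) ^ 2 + (y - b) ^ 2 ≤ s ^ 2 := by
      rintro x y ⟨a, b, h₁, h₂, h₃⟩
      exact ⟨-a, b, by linarith, by linarith, by linarith⟩
    have hy : ∀ x y : ℝ, (∃ a b : ℝ, a ^ 2 + (b - R * k) ^ 2 ≤ R ^ 2 ∧
        a ^ 2 + (b + R * k) ^ 2 ≤ R ^ 2 ∧ (x - a) ^ 2 + (y - b) ^ 2 ≤ s ^ 2) →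
        ∃ a b : ℝ, a ^ 2 + (b - R * k) ^ 2 ≤ R ^ 2 ∧
        a ^ 2 + (b + R * k) ^ 2 ≤ R ^ 2 ∧ (x - a) ^ 2 + (-y - b) ^ 2 ≤ s ^ 2 := by
      rintro x y ⟨a, b, h₁, h₂, h₃⟩
      exact ⟨a, -b, by linarith, by linarith, by linarith⟩
    constructor
    · intro h
      rcases abs_choice x with ex | ex <;> rcases abs_choice y with ey | ey <;> rw [ex, ey]
      exacts [h, hy _ _ h, hx _ _ h, hx _ _ (hy _ _ h)]
    · intro h
      rcases abs_choice x with ex | ex <;> rcases abs_choice y with ey | ey <;> rw [ex, ey] at h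
      exacts [h, by simpa using hy _ _ h, by simpa using hx _ _ h,
        by simpa using hx _ _ (hy _ _ h)]
  rw [habs, ← sq_abs x, ← sq_abs y]
  constructor
  · rintro ⟨a, b, h₁, h₂, h₃⟩
    obtain ⟨hd, hv⟩ := lens_parallel_forward hS hk hSk hRS hs (abs_nonneg y) h₁ h₂ h₃
    rcases le_or_gt |x| (1 + s * S) with h | h
    · exact Or.inl ⟨h, hd⟩
    · exact Or.inr ⟨h, hv h⟩
  · exact lens_parallel_backward hS hk hSk hRS hs (abs_nonneg x) (abs_nonneg y)

end Planar

/-! ### Area of the planar parallel body -/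

theorem integral_sqrt_sq_sub_sq_sin {a α β : ℝ} (ha : 0 ≤ a)
    (hα : α ∈ Set.Icc (-(Real.pi / 2)) (Real.pi / 2))
    (hβ : β ∈ Set.Icc (-(Real.pi / 2)) (Real.pi / 2)) :
    ∫ u in (a * Real.sin α)..(a * Real.sin β), √(a ^ 2 - u ^ 2) =
      a ^ 2 / 2 * ((β + Real.sin β * Real.cos β) - (α + Real.sin α * Real.cos α)) := by
  rw [← intervalIntegral.integral_comp_mul_deriv (f := fun θ => a * Real.sin θ)
    (f' := fun θ => a * Real.cos θ) (fun x _ => (Real.hasDerivAt_sin x).const_mul a)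
    (by fun_prop) (by fun_prop)]
  have : ∀ θ ∈ Set.uIcc α β, ((fun u => √(a ^ 2 - u ^ 2)) ∘ fun θ => a * Real.sin θ) θ *
      (a * Real.cos θ) = a ^ 2 * Real.cos θ ^ 2 := by
    intro θ hθ
    have hc : 0 ≤ Real.cos θ := Real.cos_nonneg_of_mem_Icc (Set.uIcc_subset_Icc hα hβ hθ)
    have e : a ^ 2 - (a * Real.sin θ) ^ 2 = (a * Real.cos θ) ^ 2 := by
      linear_combination (-a ^ 2) * Real.sin_sq_add_cos_sq θ
    simp only [Function.comp, e]
    rw [Real.sqrt_sq (by positivity)]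
    ring
  rw [intervalIntegral.integral_congr this, intervalIntegral.integral_const_mul, integral_cos_sq]
  ring

theorem integral_sqrt_sq_sub_sq {a : ℝ} (ha : 0 ≤ a) :
    ∫ u in (-a)..a, √(a ^ 2 - u ^ 2) = Real.pi / 2 * a ^ 2 := by
  have hpi := Real.pi_pos
  have := integral_sqrt_sq_sub_sq_sin (α := -(Real.pi / 2)) (β := Real.pi / 2) ha
    ⟨le_rfl, by linarith⟩ ⟨by linarith, le_rfl⟩
  simp only [Real.sin_neg, Real.sin_pi_div_two, Real.cos_neg, Real.cos_pi_div_two] at this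
  rw [show a * -1 = -a by ring, mul_one] at this
  rw [this]
  ring

/-- Half the length of the chord at abscissa `u ≥ 0` of the outer parallel body at distance `s` of
the planar lens with half angle `φ`. -/
def lensHalfChord (φ s u : ℝ) : ℝ :=
  if u ≤ 1 + s * Real.sin φ then
    √((1 / Real.sin φ + s) ^ 2 - u ^ 2) - 1 / Real.sin φ * Real.cos φ
  else √(s ^ 2 - (u - 1) ^ 2)

section

variable {φ s u : ℝ}

theorem lensHalfChord_nonneg (h0 : 0 < φ) (h1 : φ < Real.pi / 2) (hs : 0 ≤ s) (hu : 0 ≤ u) :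
    0 ≤ lensHalfChord φ s u := by
  have hS : 0 < Real.sin φ := Real.sin_pos_of_pos_of_lt_pi h0 (by linarith)
  have hk : 0 < Real.cos φ := Real.cos_pos_of_mem_Ioo ⟨by linarith, h1⟩
  unfold lensHalfChord
  split_ifs with h
  · rw [sub_nonneg]
    refine Real.le_sqrt_of_sq_le ?_
    set R := 1 / Real.sin φ with hR
    have hRS : R * Real.sin φ = 1 := by rw [hR]; field_simp
    have hR0 : 0 < R := by positivity
    have h2 : u ^ 2 ≤ ((R + s) * Real.sin φ) ^ 2 := by
      gcongr
      linarith
    have h3 : (R * Real.cos φ) ^ 2 ≤ ((R + s) * Real.cos φ) ^ 2 := by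
      gcongr
      linarith
    nlinarith [Real.sin_sq_add_cos_sq φ]
  · exact Real.sqrt_nonneg _

/-- Here the radicand is negative and the real square root takes its default value 0, the correct
length of an empty chord. -/
theorem lensHalfChord_of_lt (hs : 0 ≤ s) (hu : 1 + s < u) :
    lensHalfChord φ s u = 0 := by
  have hS := Real.sin_le_one φ
  unfold lensHalfChord
  rw [if_neg (by nlinarith), Real.sqrt_eq_zero_of_nonpos (by nlinarith)]

theorem integrableOn_lensHalfChord (hs : 0 ≤ s) :
    IntegrableOn (lensHalfChord φ s) (Set.Ioc 0 (1 + s * Real.sin φ)) ∧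
    IntegrableOn (lensHalfChord φ s) (Set.Ioc (1 + s * Real.sin φ) (1 + s)) ∧
    IntegrableOn (lensHalfChord φ s) (Set.Ioi (1 + s)) := by
  refine ⟨?_, ?_, ?_⟩
  · refine IntegrableOn.congr_fun
      (f := fun u => √((1 / Real.sin φ + s) ^ 2 - u ^ 2) - 1 / Real.sin φ * Real.cos φ) ?_ ?_
      measurableSet_Ioc
    · exact Continuous.integrableOn_Ioc (by fun_prop)
    · intro u hu
      simp [lensHalfChord, hu.2]
  · refine IntegrableOn.congr_fun (f := fun u => √(s ^ 2 - (u - 1) ^ 2)) ?_ ?_ measurableSet_Ioc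
    · exact Continuous.integrableOn_Ioc (by fun_prop)
    · intro u hu
      simp [lensHalfChord, hu.1.not_ge]
  · refine IntegrableOn.congr_fun (f := fun _ => 0) integrableOn_zero ?_ measurableSet_Ioi
    intro u hu
    exact (lensHalfChord_of_lt hs hu).symm

/-- The integral is the area of one quadrant. The s²(φ + sin φ cos φ) terms from the enlarged arc
and the vertex arc cancel, leaving the planar Steiner polynomial. -/
theorem integral_lensHalfChord (h0 : 0 < φ) (h1 : φ < Real.pi / 2) (hs : 0 ≤ s) :
    IntegrableOn (lensHalfChord φ s) (Set.Ioi 0) ∧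
    4 * ∫ u in Set.Ioi 0, lensHalfChord φ s u =
      (2 * φ / Real.sin φ ^ 2 - 2 * Real.cos φ / Real.sin φ) + 4 * φ / Real.sin φ * s +
        Real.pi * s ^ 2 := by
  have hS : 0 < Real.sin φ := Real.sin_pos_of_pos_of_lt_pi h0 (by linarith)
  have hS1 := Real.sin_le_one φ
  obtain ⟨i1, i2, i3⟩ := integrableOn_lensHalfChord hs
  have hle1 : (0 : ℝ) ≤ 1 + s * Real.sin φ := by positivity
  have hle2 : 1 + s * Real.sin φ ≤ 1 + s := by nlinarith
  have hu1 : Set.Ioi (1 + s * Real.sin φ) =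
      Set.Ioc (1 + s * Real.sin φ) (1 + s) ∪ Set.Ioi (1 + s) :=
    (Set.Ioc_union_Ioi_eq_Ioi hle2).symm
  have hu0 : Set.Ioi (0 : ℝ) = Set.Ioc 0 (1 + s * Real.sin φ) ∪ Set.Ioi (1 + s * Real.sin φ) :=
    (Set.Ioc_union_Ioi_eq_Ioi hle1).symm
  have i4 : IntegrableOn (lensHalfChord φ s) (Set.Ioi (1 + s * Real.sin φ)) := by
    rw [hu1]; exact i2.union i3
  have i5 : IntegrableOn (lensHalfChord φ s) (Set.Ioi 0) := by
    rw [hu0]; exact i1.union i4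
  refine ⟨i5, ?_⟩
  have v3 : ∫ u in Set.Ioi (1 + s), lensHalfChord φ s u = 0 :=
    setIntegral_eq_zero_of_forall_eq_zero fun u hu => lensHalfChord_of_lt hs hu
  have v1 : ∫ u in Set.Ioc 0 (1 + s * Real.sin φ), lensHalfChord φ s u =
      (1 / Real.sin φ + s) ^ 2 / 2 * (φ + Real.sin φ * Real.cos φ) -
        (1 + s * Real.sin φ) * (1 / Real.sin φ * Real.cos φ) := by
    rw [setIntegral_congr_fun
      (g := fun u => √((1 / Real.sin φ + s) ^ 2 - u ^ 2) - 1 / Real.sin φ * Real.cos φ)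
      measurableSet_Ioc (fun u hu => by simp [lensHalfChord, hu.2]),
      ← intervalIntegral.integral_of_le hle1, intervalIntegral.integral_sub
      (Continuous.intervalIntegrable (by fun_prop) _ _)
      (Continuous.intervalIntegrable (by fun_prop) _ _)]
    have := integral_sqrt_sq_sub_sq_sin (a := 1 / Real.sin φ + s) (α := 0) (β := φ) (by positivity)
      ⟨by linarith, by linarith⟩ ⟨by linarith, by linarith⟩
    rw [Real.sin_zero, mul_zero, show (1 / Real.sin φ + s) * Real.sin φ = 1 + s * Real.sin φ by
      field_simp] at this
    rw [this, intervalIntegral.integral_const]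
    simp
  have v2 : ∫ u in Set.Ioc (1 + s * Real.sin φ) (1 + s), lensHalfChord φ s u =
      s ^ 2 / 2 * (Real.pi / 2 - (φ + Real.sin φ * Real.cos φ)) := by
    rw [setIntegral_congr_fun (g := fun u => √(s ^ 2 - (u - 1) ^ 2))
      measurableSet_Ioc (fun u hu => by simp [lensHalfChord, hu.1.not_ge]),
      ← intervalIntegral.integral_of_le hle2,
      intervalIntegral.integral_comp_sub_right (fun u => √(s ^ 2 - u ^ 2)) 1]
    have := integral_sqrt_sq_sub_sq_sin (a := s) (α := φ) (β := Real.pi / 2) hs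
      ⟨by linarith, by linarith⟩ ⟨by linarith, by linarith⟩
    rw [Real.sin_pi_div_two, Real.cos_pi_div_two] at this
    rw [show 1 + s * Real.sin φ - 1 = s * Real.sin φ by ring, show 1 + s - 1 = s * 1 by ring, this]
    ring
  rw [hu0, setIntegral_union Set.Ioc_disjoint_Ioi_same measurableSet_Ioi i1 i4, hu1,
    setIntegral_union Set.Ioc_disjoint_Ioi_same measurableSet_Ioi i2 i3, v1, v2, v3]
  field_simp
  ring

theorem lintegral_lensHalfChord_abs (h0 : 0 < φ) (h1 : φ < Real.pi / 2) (hs : 0 ≤ s) :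
    ∫⁻ u : ℝ, ENNReal.ofReal (2 * lensHalfChord φ s |u|) = ENNReal.ofReal
      ((2 * φ / Real.sin φ ^ 2 - 2 * Real.cos φ / Real.sin φ) + 4 * φ / Real.sin φ * s +
        Real.pi * s ^ 2) := by
  obtain ⟨hi, hv⟩ := integral_lensHalfChord h0 h1 hs
  have hpos : IntegrableOn (fun u : ℝ => lensHalfChord φ s |u|) (Set.Ioi (-0)) := by
    rw [neg_zero]
    exact hi.congr_fun (fun u hu => by rw [abs_of_pos (Set.mem_Ioi.1 hu)]) measurableSet_Ioi
  have hi' : Integrable (fun u : ℝ => lensHalfChord φ s |u|) := by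
    rw [← integrableOn_univ, ← Set.Iic_union_Ioi (a := (0 : ℝ))]
    refine IntegrableOn.union ?_ ?_
    · simpa using hpos.comp_neg_Iio.congr_set_ae Iio_ae_eq_Iic.symm
    · simpa using hpos
  rw [← ofReal_integral_eq_lintegral_ofReal (hi'.const_mul 2)
    (Filter.Eventually.of_forall fun u => by
      have := lensHalfChord_nonneg h0 h1 hs (abs_nonneg u)
      positivity), integral_const_mul, integral_comp_abs, ← hv]
  congr 1
  ring

end

/-! ### Slicing three-space by height -/

/-- The height comes first so that Tonelli integrates over horizontal slices. -/
theorem measurePreserving_euc_three :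
    MeasurePreserving (fun x : Euc 3 => (x 2, x 0, x 1)) := by
  have h1 : MeasurePreserving (WithLp.ofLp : Euc 3 → Fin 3 → ℝ) :=
    PiLp.volume_preserving_ofLp (Fin 3)
  have h2 := volume_preserving_piFinSuccAbove (fun _ : Fin 3 => ℝ) 2
  have h3 := (MeasurePreserving.id (volume : Measure ℝ)).prod (volume_preserving_finTwoArrow ℝ)
  exact h3.comp (h2.comp h1)

theorem volume_eq_lintegral_lintegral {S : Set (Euc 3)} (hS : MeasurableSet S) :
    volume S = ∫⁻ z : ℝ, ∫⁻ x : ℝ, volume {y : ℝ | (!₂[x, y, z] : Euc 3) ∈ S} := by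
  set g : ℝ × ℝ × ℝ → Euc 3 := fun p => !₂[p.2.1, p.2.2, p.1] with hg
  have hgm : Measurable g := by
    refine (WithLp.measurable_toLp 2 (Fin 3 → ℝ)).comp ?_
    rw [measurable_pi_iff]
    intro i
    fin_cases i <;> simp <;> fun_prop
  have hT : MeasurableSet (g ⁻¹' S) := hgm hS
  have hpre : (fun x : Euc 3 => (x 2, x 0, x 1)) ⁻¹' (g ⁻¹' S) = S := by
    ext x
    have : g (x 2, x 0, x 1) = x := by
      ext i
      fin_cases i <;> rfl
    simp [this]
  rw [← hpre, measurePreserving_euc_three.measure_preimage hT.nullMeasurableSet, hpre,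
    Measure.volume_eq_prod, Measure.prod_apply hT]
  refine lintegral_congr fun z => ?_
  rw [Measure.volume_eq_prod, Measure.prod_apply (measurable_prodMk_left hT)]
  rfl

section

variable {φ : ℝ}

theorem mem_symmetricLens_iff (hS : 0 < Real.sin φ) {x : Euc 3} :
    x ∈ symmetricLens φ ↔ x 2 = 0 ∧
      x 0 ^ 2 + (x 1 - 1 / Real.sin φ * Real.cos φ) ^ 2 ≤ (1 / Real.sin φ) ^ 2 ∧
      x 0 ^ 2 + (x 1 + 1 / Real.sin φ * Real.cos φ) ^ 2 ≤ (1 / Real.sin φ) ^ 2 := by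
  have hR : 0 ≤ 1 / Real.sin φ := by positivity
  have hc : Real.cos φ / Real.sin φ = 1 / Real.sin φ * Real.cos φ := by ring
  simp only [symmetricLens, Set.mem_ofPred_eq, Metric.mem_closedBall, EuclideanSpace.dist_eq,
    Real.sqrt_le_left hR, Fin.sum_univ_three, Real.dist_eq, sq_abs, hc]
  refine and_congr_right fun h => ?_
  simp [h]

theorem mem_symmetricLens_add_closedBall_iff (hS : 0 < Real.sin φ) {t : ℝ} (ht : 0 ≤ t)
    {x : Euc 3} :
    x ∈ symmetricLens φ + Metric.closedBall 0 t ↔ ∃ a b : ℝ,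
      a ^ 2 + (b - 1 / Real.sin φ * Real.cos φ) ^ 2 ≤ (1 / Real.sin φ) ^ 2 ∧
      a ^ 2 + (b + 1 / Real.sin φ * Real.cos φ) ^ 2 ≤ (1 / Real.sin φ) ^ 2 ∧
      (x 0 - a) ^ 2 + (x 1 - b) ^ 2 + x 2 ^ 2 ≤ t ^ 2 := by
  have hnorm : ∀ v : Euc 3, v ∈ Metric.closedBall 0 t ↔ v 0 ^ 2 + v 1 ^ 2 + v 2 ^ 2 ≤ t ^ 2 := by
    intro v
    simp [EuclideanSpace.norm_eq, Real.sqrt_le_left ht, Fin.sum_univ_three]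
  constructor
  · rintro ⟨l, hl, v, hv, rfl⟩
    obtain ⟨h0, h1, h2⟩ := (mem_symmetricLens_iff hS).1 hl
    refine ⟨l 0, l 1, h1, h2, ?_⟩
    simpa [h0] using (hnorm v).1 hv
  · rintro ⟨a, b, h1, h2, h3⟩
    refine ⟨!₂[a, b, 0], (mem_symmetricLens_iff hS).2 ⟨by simp, by simpa using h1, by simpa using h2⟩,
      x - !₂[a, b, 0], (hnorm _).2 (by simpa using h3), by simp⟩

theorem volume_lens_chord (h0 : 0 < φ) (h1 : φ < Real.pi / 2) {s : ℝ} (hs : 0 ≤ s) (x : ℝ) :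
    volume {y : ℝ | ∃ a b : ℝ,
      a ^ 2 + (b - 1 / Real.sin φ * Real.cos φ) ^ 2 ≤ (1 / Real.sin φ) ^ 2 ∧
      a ^ 2 + (b + 1 / Real.sin φ * Real.cos φ) ^ 2 ≤ (1 / Real.sin φ) ^ 2 ∧
      (x - a) ^ 2 + (y - b) ^ 2 ≤ s ^ 2} = ENNReal.ofReal (2 * lensHalfChord φ s |x|) := by
  have hS : 0 < Real.sin φ := Real.sin_pos_of_pos_of_lt_pi h0 (by linarith)
  have hk : 0 < Real.cos φ := Real.cos_pos_of_mem_Ioo ⟨by linarith, h1⟩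
  have hRS : 1 / Real.sin φ * Real.sin φ = 1 := by field_simp
  have hRk : 0 < 1 / Real.sin φ * Real.cos φ := by positivity
  simp only [exists_lens_dist_le_iff hS hk (Real.sin_sq_add_cos_sq φ) hRS hs]
  have hIcc : ∀ h : ℝ, volume (Set.Icc (-h) h) = ENNReal.ofReal (2 * h) := fun h => by
    rw [Real.volume_Icc]; ring_nf
  rcases le_or_gt |x| (1 + s * Real.sin φ) with hx | hx
  · rw [← hIcc]
    congr 1
    ext y
    simp only [lensHalfChord, hx, hx.not_gt, true_and, false_and, or_false, if_true,
      Set.mem_ofPred_eq, sq_abs]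
    rw [Set.mem_Icc, ← abs_le, le_sub_iff_add_le, Real.le_sqrt' (by positivity)]
    constructor <;> intro h <;> linarith
  · simp only [lensHalfChord, hx, hx.not_ge, true_and, false_and, false_or, if_false]
    rcases le_or_gt 0 (s ^ 2 - (|x| - 1) ^ 2) with hd | hd
    · rw [← hIcc]
      congr 1
      ext y
      rw [Set.mem_Icc, ← abs_le, Real.le_sqrt (abs_nonneg y) hd, sq_abs, Set.mem_ofPred_eq]
      constructor <;> intro h <;> linarith
    -- The chord is empty, matching the default value 0 of the square root.
    · rw [Real.sqrt_eq_zero_of_nonpos hd.le]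
      have : {y : ℝ | (|x| - 1) ^ 2 + y ^ 2 ≤ s ^ 2} = ∅ := by
        ext y
        simp only [Set.mem_ofPred_eq, Set.mem_empty_iff_false, iff_false]
        nlinarith [sq_nonneg y]
      simp [this]

theorem isCompact_symmetricLens (φ : ℝ) : IsCompact (symmetricLens φ) := by
  refine ((isCompact_closedBall (!₂[0, Real.cos φ / Real.sin φ, 0] : Euc 3)
    (1 / Real.sin φ)).inter (isCompact_closedBall
    (!₂[0, -(Real.cos φ / Real.sin φ), 0] : Euc 3) (1 / Real.sin φ))).inter_left
    (?_ : IsClosed {x : Euc 3 | x 2 = 0})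
  exact isClosed_eq (by fun_prop) continuous_const

theorem lens_area_nonneg (h0 : 0 < φ) (hS : 0 < Real.sin φ) :
    0 ≤ 2 * φ / Real.sin φ ^ 2 - 2 * Real.cos φ / Real.sin φ := by
  have h2 : Real.cos φ * Real.sin φ ≤ φ := by
    nlinarith [Real.sin_le h0.le, Real.cos_le_one φ]
  have : 2 * φ / Real.sin φ ^ 2 - 2 * Real.cos φ / Real.sin φ =
      2 * (φ - Real.cos φ * Real.sin φ) / Real.sin φ ^ 2 := by
    field_simp
  rw [this]
  have := sub_nonneg.2 h2
  positivity

/-- Steiner's formula for the planar lens in three-space. -/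
theorem volume_symmetricLens_add_closedBall (h0 : 0 < φ) (h1 : φ < Real.pi / 2) {t : ℝ}
    (ht : 0 ≤ t) :
    volume (symmetricLens φ + Metric.closedBall (0 : Euc 3) t) = ENNReal.ofReal
      (2 * (2 * φ / Real.sin φ ^ 2 - 2 * Real.cos φ / Real.sin φ) * t +
        Real.pi / 2 * (4 * φ / Real.sin φ) * t ^ 2 + 4 / 3 * Real.pi * t ^ 3) := by
  have hS : 0 < Real.sin φ := Real.sin_pos_of_pos_of_lt_pi h0 (by linarith)
  have hk : 0 < Real.cos φ := Real.cos_pos_of_mem_Ioo ⟨by linarith, h1⟩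
  have hpi := Real.pi_pos
  set A := 2 * φ / Real.sin φ ^ 2 - 2 * Real.cos φ / Real.sin φ with hA
  set P := 4 * φ / Real.sin φ with hP
  have hA0 : 0 ≤ A := lens_area_nonneg h0 hS
  have hP0 : 0 ≤ P := by positivity
  have hmeas : MeasurableSet (symmetricLens φ + Metric.closedBall (0 : Euc 3) t) :=
    ((isCompact_symmetricLens φ).add (isCompact_closedBall 0 t)).measurableSet
  rw [volume_eq_lintegral_lintegral hmeas]
  simp only [mem_symmetricLens_add_closedBall_iff hS ht]
  -- Moving z² to the right-hand side turns the slice into a planar parallel body at distance √(t² -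
  -- z²).
  have hslice : ∀ z : ℝ, (∫⁻ x : ℝ, volume {y : ℝ | ∃ a b : ℝ,
      a ^ 2 + (b - 1 / Real.sin φ * Real.cos φ) ^ 2 ≤ (1 / Real.sin φ) ^ 2 ∧
      a ^ 2 + (b + 1 / Real.sin φ * Real.cos φ) ^ 2 ≤ (1 / Real.sin φ) ^ 2 ∧
      (x - a) ^ 2 + (y - b) ^ 2 + z ^ 2 ≤ t ^ 2}) =
      (Set.Icc (-t) t).indicator (fun z => ENNReal.ofReal
        (A + P * √(t ^ 2 - z ^ 2) + Real.pi * (t ^ 2 - z ^ 2))) z := by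
    intro z
    by_cases hz : z ∈ Set.Icc (-t) t
    · have hz2 : 0 ≤ t ^ 2 - z ^ 2 := by nlinarith [hz.1, hz.2]
      rw [Set.indicator_of_mem hz]
      have hs : √(t ^ 2 - z ^ 2) ^ 2 = t ^ 2 - z ^ 2 := Real.sq_sqrt hz2
      rw [← hs, Real.sqrt_sq (Real.sqrt_nonneg _),
        ← lintegral_lensHalfChord_abs h0 h1 (Real.sqrt_nonneg _)]
      refine lintegral_congr fun x => ?_
      rw [← volume_lens_chord h0 h1 (Real.sqrt_nonneg _), hs]
      simp only [le_sub_iff_add_le]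
    · rw [Set.indicator_of_notMem hz]
      have hz2 : t ^ 2 < z ^ 2 := by
        by_contra! h
        exact hz (Set.mem_Icc.2 (abs_le_of_sq_le_sq' h ht))
      have hempty : ∀ x : ℝ, {y : ℝ | ∃ a b : ℝ,
          a ^ 2 + (b - 1 / Real.sin φ * Real.cos φ) ^ 2 ≤ (1 / Real.sin φ) ^ 2 ∧
          a ^ 2 + (b + 1 / Real.sin φ * Real.cos φ) ^ 2 ≤ (1 / Real.sin φ) ^ 2 ∧
          (x - a) ^ 2 + (y - b) ^ 2 + z ^ 2 ≤ t ^ 2} = ∅ := by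
        intro x
        ext y
        simp only [Set.mem_ofPred_eq, Set.mem_empty_iff_false, iff_false]
        rintro ⟨a, b, -, -, h⟩
        nlinarith [sq_nonneg (x - a), sq_nonneg (y - b)]
      simp only [hempty, measure_empty, lintegral_zero]
  refine (lintegral_congr hslice).trans ?_
  clear_value A P
  rw [lintegral_indicator measurableSet_Icc, ← ofReal_integral_eq_lintegral_ofReal
    (Continuous.integrableOn_Icc (by fun_prop))]
  · congr 1
    rw [integral_Icc_eq_integral_Ioc, ← intervalIntegral.integral_of_le (by linarith),
      intervalIntegral.integral_add (Continuous.intervalIntegrable (by fun_prop) _ _)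
      (Continuous.intervalIntegrable (by fun_prop) _ _),
      intervalIntegral.integral_add (Continuous.intervalIntegrable (by fun_prop) _ _)
      (Continuous.intervalIntegrable (by fun_prop) _ _),
      intervalIntegral.integral_const_mul, integral_sqrt_sq_sub_sq ht,
      intervalIntegral.integral_const_mul,
      intervalIntegral.integral_sub (Continuous.intervalIntegrable (by fun_prop) _ _)
      (Continuous.intervalIntegrable (by fun_prop) _ _), integral_pow]
    simp only [intervalIntegral.integral_const, smul_eq_mul]
    push_cast
    ring
  · refine (ae_restrict_iff' measurableSet_Icc).2 (Filter.Eventually.of_forall fun z hz => ?_)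
    have : 0 ≤ t ^ 2 - z ^ 2 := by nlinarith [hz.1, hz.2]
    simp only [Pi.zero_apply]
    positivity

end

/-! ### Numerics: angle, area and roots -/

/-- Imaginary part of the exponential remainder at ix with 16 terms; that bound needs |x|/17 ≤ 1/2,
which |x| ≤ 8 ensures. -/
theorem abs_sin_sub_taylor_le {x : ℝ} (hx : |x| ≤ 8) :
    |Real.sin x - (x - x ^ 3 / 6 + x ^ 5 / 120 - x ^ 7 / 5040 + x ^ 9 / 362880 -
      x ^ 11 / 39916800 + x ^ 13 / 6227020800 - x ^ 15 / 1307674368000)| ≤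
      |x| ^ 16 / 20922789888000 * 2 := by
  have hn : ‖(x : ℂ) * Complex.I‖ = |x| := by simp
  have h := Complex.exp_bound' (x := x * Complex.I) (n := 16) (by
    rw [hn, div_le_iff₀ (by positivity)]; norm_num; linarith)
  rw [hn] at h
  have h2 := (Complex.abs_im_le_norm _).trans h
  have hI : ∀ m : ℕ, Complex.I ^ (m + 2) = -Complex.I ^ m := fun m => by
    rw [pow_add, Complex.I_sq]; ring
  have e : (Complex.exp (x * Complex.I) -
      ∑ m ∈ Finset.range 16, (x * Complex.I) ^ m / (m.factorial : ℂ)).im =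
      Real.sin x - (x - x ^ 3 / 6 + x ^ 5 / 120 - x ^ 7 / 5040 + x ^ 9 / 362880 -
      x ^ 11 / 39916800 + x ^ 13 / 6227020800 - x ^ 15 / 1307674368000) := by
    have e1 : ∑ m ∈ Finset.range 16, (x * Complex.I) ^ m / (m.factorial : ℂ) =
      ((1 - x ^ 2 / 2 + x ^ 4 / 24 - x ^ 6 / 720 + x ^ 8 / 40320 - x ^ 10 / 3628800 +
        x ^ 12 / 479001600 - x ^ 14 / 87178291200 : ℝ) : ℂ) +
      ((x - x ^ 3 / 6 + x ^ 5 / 120 - x ^ 7 / 5040 + x ^ 9 / 362880 -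
      x ^ 11 / 39916800 + x ^ 13 / 6227020800 - x ^ 15 / 1307674368000 : ℝ) : ℂ) * Complex.I := by
      simp only [Finset.sum_range_succ, Finset.sum_range_zero, mul_pow, hI, Nat.factorial, pow_zero,
        pow_one]
      push_cast
      ring
    rw [e1, Complex.exp_mul_I, ← Complex.ofReal_cos, ← Complex.ofReal_sin]
    simp only [Complex.sub_im, Complex.add_im, Complex.ofReal_im, Complex.im_ofReal_mul,
      Complex.I_im, mul_one, zero_add]
  rw [e] at h2
  simpa [Nat.factorial] using h2

/-- Intermediate value theorem for 5.2 sin x - 4x. A bracket of width 10⁻⁸ fixes the area to within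
10⁻⁷, enough for the tolerance 10⁻⁶ on z. -/
theorem exists_lens_angle : ∃ φ : ℝ, 1.22149621 ≤ φ ∧ φ ≤ 1.22149622 ∧
    5.2 * Real.sin φ = 4 * φ := by
  have hlow : 0 ≤ 5.2 * Real.sin 1.22149621 - 4 * 1.22149621 := by
    have h := abs_le.1 (abs_sin_sub_taylor_le (x := 1.22149621) (by rw [abs_of_pos] <;> norm_num))
    rw [abs_of_pos (by norm_num)] at h
    have h1 := h.1
    norm_num at h1 ⊢
    linarith
  have hhigh : 5.2 * Real.sin 1.22149622 - 4 * 1.22149622 ≤ 0 := by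
    have h := abs_le.1 (abs_sin_sub_taylor_le (x := 1.22149622) (by rw [abs_of_pos] <;> norm_num))
    rw [abs_of_pos (by norm_num)] at h
    have h1 := h.2
    norm_num at h1 ⊢
    linarith
  obtain ⟨φ, hφ, h⟩ := intermediate_value_Icc' (a := (1.22149621 : ℝ)) (b := 1.22149622)
    (f := fun x => 5.2 * Real.sin x - 4 * x) (by norm_num) (by fun_prop)
    (Set.mem_Icc.2 ⟨hhigh, hlow⟩)
  exact ⟨φ, hφ.1, hφ.2, by simpa [sub_eq_zero] using h⟩

theorem lensArea_bounds {φ : ℝ} (h1 : 1.22149621 ≤ φ) (h2 : φ ≤ 1.22149622)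
    (h : 5.2 * Real.sin φ = 4 * φ) :
    2.03862707 ≤ lensArea 5.2 φ ∧ lensArea 5.2 φ ≤ 2.03862717 := by
  have hpi := Real.pi_gt_d2
  -- No Taylor bound for the cosine is needed: sin φ = 10φ/13 gives cos² φ, and positivity picks the
  -- sign.
  have hc0 : 0 < Real.cos φ := Real.cos_pos_of_mem_Ioo ⟨by linarith, by linarith⟩
  have hsq : Real.cos φ ^ 2 = 1 - (φ * (10 / 13)) ^ 2 := by
    have : Real.sin φ = φ * (10 / 13) := by linarith
    rw [← this, Real.cos_sq']
  have hc1 : 0.34224025 ≤ Real.cos φ := by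
    refine abs_le_of_sq_le_sq' ?_ hc0.le |>.2
    rw [hsq]; nlinarith
  have hc2 : Real.cos φ ≤ 0.34224028 := by
    refine abs_le_of_sq_le_sq' ?_ (by norm_num) |>.2
    rw [hsq]; nlinarith
  unfold lensArea
  rw [le_div_iff₀ (by linarith), div_le_iff₀ (by linarith)]
  constructor <;> linarith

theorem steiner_quadratic_bounds {A : ℝ} (hA1 : 2.03862707 ≤ A) (hA2 : A ≤ 2.03862717) :
    ∃ x y : ℝ, |x - (-0.503393)| < 10 ^ (-6 : ℤ) ∧ |y - 0.038442| < 10 ^ (-6 : ℤ) ∧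
      (2 * A + Real.pi / 2 * 5.2 + 4 / 3 * Real.pi) * (-2 * x) =
        Real.pi / 2 * 5.2 + 8 / 3 * Real.pi ∧
      (2 * A + Real.pi / 2 * 5.2 + 4 / 3 * Real.pi) * (x ^ 2 + y ^ 2) = 4 / 3 * Real.pi := by
  have hp1 := Real.pi_gt_d20
  have hp2 := Real.pi_lt_d20
  set a := 2 * A + Real.pi / 2 * 5.2 + 4 / 3 * Real.pi with ha
  set b := Real.pi / 2 * 5.2 + 8 / 3 * Real.pi with hb
  set c := 4 / 3 * Real.pi with hc
  have ha1 : 16.4341852 ≤ a := by linarith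
  have ha2 : a ≤ 16.4341855 := by linarith
  have hb1 : 16.5457213089 ≤ b := by linarith
  have hb2 : b ≤ 16.5457213090 := by linarith
  have hc1 : 4.1887902047 ≤ c := by linarith
  have hc2 : c ≤ 4.1887902048 := by linarith
  clear_value a b c
  have ha0 : 0 < a := by linarith
  -- By Vieta for as² + bs + c, w = -Re z and q = |z|², so (Im z)² = q - w².
  obtain ⟨w, hw⟩ : ∃ w, w = b / (2 * a) := ⟨_, rfl⟩
  obtain ⟨q, hq⟩ : ∃ q, q = c / a := ⟨_, rfl⟩
  have hw1 : 0.503393405 ≤ w := by rw [hw, le_div_iff₀ (by positivity)]; linarith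
  have hw2 : w ≤ 0.50339342 := by rw [hw, div_le_iff₀ (by positivity)]; linarith
  have hq1 : 0.25488273 ≤ q := by rw [hq, le_div_iff₀ ha0]; linarith
  have hq2 : q ≤ 0.25488275 := by rw [hq, div_le_iff₀ ha0]; linarith
  have hwa : a * (2 * w) = b := by rw [hw]; field_simp
  have hqa : a * q = c := by rw [hq]; field_simp
  have hd1 : 0.0384415 ^ 2 ≤ q - w ^ 2 := by nlinarith
  have hd2 : q - w ^ 2 ≤ 0.0384427 ^ 2 := by nlinarith
  have hy1 : 0.0384415 ≤ √(q - w ^ 2) := Real.le_sqrt_of_sq_le hd1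
  have hy2 : √(q - w ^ 2) ≤ 0.0384427 := by
    rw [Real.sqrt_le_left (by norm_num)]; exact hd2
  refine ⟨-w, √(q - w ^ 2), ?_, ?_, ?_, ?_⟩
  · rw [abs_lt]
    norm_num
    constructor <;> linarith
  · rw [abs_lt]
    norm_num
    constructor <;> linarith
  · linarith
  · rw [Real.sq_sqrt (le_trans (by norm_num) hd1), ← hqa]; ring

theorem roots_lensCubic {A p x y : ℝ} (ha : 2 * A + Real.pi / 2 * p + 4 / 3 * Real.pi ≠ 0)
    (hsum : (2 * A + Real.pi / 2 * p + 4 / 3 * Real.pi) * (-2 * x) =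
      Real.pi / 2 * p + 8 / 3 * Real.pi)
    (hprod : (2 * A + Real.pi / 2 * p + 4 / 3 * Real.pi) * (x ^ 2 + y ^ 2) = 4 / 3 * Real.pi) :
    (lensCubic A p).roots = {-1, (⟨x, y⟩ : ℂ), (starRingEnd ℂ) ⟨x, y⟩} := by
  set a := 2 * A + Real.pi / 2 * p + 4 / 3 * Real.pi with haa
  set z : ℂ := ⟨x, y⟩ with hz
  have h1 : z + (starRingEnd ℂ) z = ((2 * x : ℝ) : ℂ) := by
    rw [Complex.add_conj]
  have h2 : z * (starRingEnd ℂ) z = ((x ^ 2 + y ^ 2 : ℝ) : ℂ) := by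
    rw [Complex.mul_conj, Complex.normSq_mk]; congr 1; ring
  have e2 : 2 * A + Real.pi * p + 4 * Real.pi = a * (1 - 2 * x) := by linarith
  have e1 : Real.pi / 2 * p + 4 * Real.pi = a * (x ^ 2 + y ^ 2 - 2 * x) := by linarith
  have hfac : lensCubic A p =
      C (a : ℂ) * ((X - C (-1)) * ((X - C z) * (X - C ((starRingEnd ℂ) z)))) := by
    have h3 : (X - C z) * (X - C ((starRingEnd ℂ) z)) =
        X ^ 2 - C (z + (starRingEnd ℂ) z) * X + C (z * (starRingEnd ℂ) z) := by
      simp only [C_add, C_mul]; ring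
    rw [h3, h1, h2, lensCubic, ← haa, e1, e2, ← hprod]
    simp only [Complex.ofReal_mul, Complex.ofReal_sub, Complex.ofReal_add, Complex.ofReal_pow,
      Complex.ofReal_one, Complex.ofReal_ofNat, C_mul, C_sub, C_add, C_1, C_neg, C_pow]
    ring
  have hne : (X - C (-1)) * ((X - C z) * (X - C ((starRingEnd ℂ) z))) ≠ 0 :=
    mul_ne_zero (X_sub_C_ne_zero _) (mul_ne_zero (X_sub_C_ne_zero _) (X_sub_C_ne_zero _))
  rw [hfac, roots_C_mul _ (by exact_mod_cast ha), roots_mul hne,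
    roots_mul (mul_ne_zero (X_sub_C_ne_zero _) (X_sub_C_ne_zero _)), roots_X_sub_C, roots_X_sub_C,
    roots_X_sub_C]
  rfl

/-! ### The body L + B and its relative inradius -/

theorem convex_symmetricLens (φ : ℝ) : Convex ℝ (symmetricLens φ) := by
  have h : Convex ℝ {x : Euc 3 | x 2 = 0} := by
    intro x hx y hy a b _ _ _
    simp_all
  exact h.inter ((convex_closedBall _ _).inter (convex_closedBall _ _))

section

variable {φ : ℝ}

theorem symmetricLens_subset_closedBall (hS : 0 < Real.sin φ) :
    symmetricLens φ ⊆ Metric.closedBall 0 1 := by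
  intro x hx
  obtain ⟨h0, h1, h2⟩ := (mem_symmetricLens_iff hS).1 hx
  have hR : (1 : ℝ) + (1 / Real.sin φ * Real.cos φ) ^ 2 = (1 / Real.sin φ) ^ 2 := by
    field_simp
    exact Real.sin_sq_add_cos_sq φ
  simp only [Metric.mem_closedBall, dist_zero_right, EuclideanSpace.norm_eq, Fin.sum_univ_three,
    Real.norm_eq_abs, sq_abs, h0]
  rw [Real.sqrt_le_left zero_le_one]
  nlinarith

theorem mem_symmetricLens_of_abs_le_one (hS : 0 < Real.sin φ) {a : ℝ} (ha : |a| ≤ 1) :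
    (!₂[a, 0, 0] : Euc 3) ∈ symmetricLens φ := by
  have hR : (1 : ℝ) + (1 / Real.sin φ * Real.cos φ) ^ 2 = (1 / Real.sin φ) ^ 2 := by
    field_simp
    exact Real.sin_sq_add_cos_sq φ
  have ha2 : a ^ 2 ≤ 1 := (sq_le_one_iff_abs_le_one a).2 ha
  refine (mem_symmetricLens_iff hS).2 ⟨rfl, ?_, ?_⟩
  · change a ^ 2 + (0 - _) ^ 2 ≤ _
    linarith
  · change a ^ 2 + (0 + _) ^ 2 ≤ _
    linarith

theorem zero_mem_symmetricLens (hS : 0 < Real.sin φ) : (0 : Euc 3) ∈ symmetricLens φ := by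
  have : (!₂[0, 0, 0] : Euc 3) = 0 := by
    ext i
    fin_cases i <;> rfl
  exact this ▸ mem_symmetricLens_of_abs_le_one hS (a := 0) (by simp)

/-- The outer parallel body at distance one of the symmetric lens. -/
def lensBody (φ : ℝ) (hS : 0 < Real.sin φ) : ConvexBody (Euc 3) where
  carrier := symmetricLens φ + Metric.closedBall 0 1
  convex' := (convex_symmetricLens φ).add (convex_closedBall 0 1)
  isCompact' := (isCompact_symmetricLens φ).add (isCompact_closedBall 0 1)
  nonempty' := ⟨0 + 0, Set.add_mem_add (zero_mem_symmetricLens hS)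
    (Metric.mem_closedBall_self zero_le_one)⟩

theorem coe_lensBody (hS : 0 < Real.sin φ) :
    (lensBody φ hS : Set (Euc 3)) = symmetricLens φ + Metric.closedBall 0 1 := rfl

theorem coe_unitBall (n : ℕ) : (unitBall n : Set (Euc n)) = Metric.closedBall 0 1 := rfl

theorem interior_lensBody_nonempty (hS : 0 < Real.sin φ) :
    (interior (lensBody φ hS : Set (Euc 3))).Nonempty := by
  refine ⟨0, interior_mono (s := Metric.closedBall (0 : Euc 3) 1) ?_ ?_⟩
  · intro x hx
    exact ⟨0, zero_mem_symmetricLens hS, x, hx, zero_add x⟩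
  · exact Metric.ball_subset_interior_closedBall (Metric.mem_ball_self zero_lt_one)

theorem isRelInradius_lensBody (hS : 0 < Real.sin φ) :
    IsRelInradius (unitBall 3) (lensBody φ hS) (1 / 2) := by
  constructor
  · refine ⟨0, ?_⟩
    rw [zero_vadd, coe_lensBody, coe_unitBall]
    rintro _ ⟨_, ⟨l, hl, v, hv, rfl⟩, rfl⟩
    have h1 := symmetricLens_subset_closedBall hS hl
    rw [Metric.mem_closedBall, dist_zero_right] at *
    change ‖(1 / 2 : ℝ) • (l + v)‖ ≤ 1
    rw [norm_smul, Real.norm_of_nonneg (by norm_num)]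
    linarith [norm_add_le l v]
  · rintro t ⟨x, hx⟩
    rw [coe_lensBody, coe_unitBall] at hx
    -- The vertices (±1, 0, 0) lie in both L and B, so (±2, 0, 0) lie in the body; the first
    -- coordinates of their images then force 4t ≤ 2.
    have hmem : ∀ a : ℝ, |a| ≤ 1 → ‖x + t • ((!₂[a, 0, 0] : Euc 3) + !₂[a, 0, 0])‖ ≤ 1 := by
      intro a ha
      have hl := mem_symmetricLens_of_abs_le_one hS ha
      have := hx ⟨_, ⟨_, ⟨_, hl, _, symmetricLens_subset_closedBall hS hl, rfl⟩, rfl⟩, rfl⟩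
      simpa using this
    have h1 := (abs_le.1 ((PiLp.norm_apply_le _ 0).trans (hmem 1 (by simp)))).2
    have h2 := (abs_le.1 ((PiLp.norm_apply_le _ 0).trans (hmem (-1) (by simp)))).1
    simp at h1 h2
    linarith

/-! ### Quermassintegrals and the Steiner polynomial -/

theorem volume_real_unitBall_add_smul_lensBody (h0 : 0 < φ) (h1 : φ < Real.pi / 2)
    (hS : 0 < Real.sin φ) {ρ : ℝ} (hρ : 0 ≤ ρ) :
    volume.real ((unitBall 3 + ρ • lensBody φ hS : ConvexBody (Euc 3)) : Set (Euc 3)) =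
      2 * (2 * φ / Real.sin φ ^ 2 - 2 * Real.cos φ / Real.sin φ) * ρ ^ 2 * (1 + ρ) +
        Real.pi / 2 * (4 * φ / Real.sin φ) * ρ * (1 + ρ) ^ 2 +
        4 / 3 * Real.pi * (1 + ρ) ^ 3 := by
  rw [ConvexBody.coe_add, ConvexBody.coe_smul, coe_lensBody, coe_unitBall]
  have hk : 0 < Real.cos φ := Real.cos_pos_of_mem_Ioo ⟨by linarith, h1⟩
  have hpi := Real.pi_pos
  have hA0 : 0 ≤ 2 * φ / Real.sin φ ^ 2 - 2 * Real.cos φ / Real.sin φ :=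
    lens_area_nonneg h0 hS
  -- The rescaling by 1/ρ excludes ρ = 0, where the sum is just the unit ball.
  rcases hρ.eq_or_lt with rfl | hρ
  · rw [Set.zero_smul_set ⟨0 + 0, Set.add_mem_add (zero_mem_symmetricLens hS)
      (Metric.mem_closedBall_self zero_le_one)⟩, add_zero, Measure.real,
      EuclideanSpace.volume_closedBall_fin_three]
    simp only [ENNReal.ofReal_one, one_pow, one_mul]
    rw [ENNReal.toReal_ofReal (by positivity)]
    ring
  · have hset : Metric.closedBall (0 : Euc 3) 1 +
        ρ • (symmetricLens φ + Metric.closedBall (0 : Euc 3) 1) =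
        ρ • (symmetricLens φ + Metric.closedBall (0 : Euc 3) (1 / ρ + 1)) := by
      have hb : Metric.closedBall (0 : Euc 3) (1 / ρ + 1) =
          ρ⁻¹ • Metric.closedBall (0 : Euc 3) 1 + Metric.closedBall (0 : Euc 3) 1 := by
        rw [smul_closedBall _ _ zero_le_one, smul_zero, closedBall_add_closedBall (by positivity)
          zero_le_one, Real.norm_of_nonneg (by positivity)]
        simp
      rw [hb, smul_add, smul_add, smul_add, smul_inv_smul₀ hρ.ne', add_left_comm]
    rw [hset, Measure.real, Measure.addHaar_smul,
      volume_symmetricLens_add_closedBall h0 h1 (by positivity), ENNReal.toReal_mul,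
      ENNReal.toReal_ofReal (by positivity), ENNReal.toReal_ofReal (by positivity)]
    simp only [finrank_euclideanSpace, Fintype.card_fin]
    rw [abs_of_pos (by positivity)]
    generalize 2 * φ / Real.sin φ ^ 2 - 2 * Real.cos φ / Real.sin φ = A
    generalize 4 * φ / Real.sin φ = P
    field_simp

/-- The relative quermassintegrals of the unit ball with respect to the outer parallel body of the
lens with area `A` and perimeter `p`. -/
def lensQuermassintegrals (A p : ℝ) : Fin 4 → ℝ :=
  ![4 / 3 * Real.pi, (Real.pi / 2 * p + 4 * Real.pi) / 3, (2 * A + Real.pi * p + 4 * Real.pi) / 3,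
    2 * A + Real.pi / 2 * p + 4 / 3 * Real.pi]

theorem steinerPolynomial_lensQuermassintegrals (A p : ℝ) :
    steinerPolynomial (n := 3) (lensQuermassintegrals A p) = lensCubic A p := by
  refine (Fin.sum_univ_four _).trans ?_
  have e0 : ((Nat.choose 3 0 : ℕ) : ℝ) * (4 / 3 * Real.pi) = 4 / 3 * Real.pi := by simp
  have e1 : ((Nat.choose 3 1 : ℕ) : ℝ) * ((Real.pi / 2 * p + 4 * Real.pi) / 3) =
      Real.pi / 2 * p + 4 * Real.pi := by
    norm_num [Nat.choose]; ring
  have e2 : ((Nat.choose 3 2 : ℕ) : ℝ) * ((2 * A + Real.pi * p + 4 * Real.pi) / 3) =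
      2 * A + Real.pi * p + 4 * Real.pi := by
    norm_num [Nat.choose]; ring
  have e3 : ((Nat.choose 3 3 : ℕ) : ℝ) * (2 * A + Real.pi / 2 * p + 4 / 3 * Real.pi) =
      2 * A + Real.pi / 2 * p + 4 / 3 * Real.pi := by simp
  change C (((Nat.choose 3 0 : ℕ) * (4 / 3 * Real.pi) : ℝ) : ℂ) * X ^ 0 +
    C (((Nat.choose 3 1 : ℕ) * ((Real.pi / 2 * p + 4 * Real.pi) / 3) : ℝ) : ℂ) * X ^ 1 +
    C (((Nat.choose 3 2 : ℕ) * ((2 * A + Real.pi * p + 4 * Real.pi) / 3) : ℝ) : ℂ) * X ^ 2 +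
    C (((Nat.choose 3 3 : ℕ) * (2 * A + Real.pi / 2 * p + 4 / 3 * Real.pi) : ℝ) : ℂ) * X ^ 3 = _
  rw [e0, e1, e2, e3, lensCubic]
  ring

theorem lensArea_eq (h0 : 0 < φ) (hS : 0 < Real.sin φ) {p : ℝ} (hp : p * Real.sin φ = 4 * φ) :
    lensArea p φ = 2 * φ / Real.sin φ ^ 2 - 2 * Real.cos φ / Real.sin φ := by
  have : p = 4 * φ / Real.sin φ := by field_simp; exact hp
  rw [lensArea, this]
  field_simp
  ring

theorem isRelQuermassintegrals_lensBody (h0 : 0 < φ) (h1 : φ < Real.pi / 2)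
    (hS : 0 < Real.sin φ) {p : ℝ} (hp : p * Real.sin φ = 4 * φ) :
    IsRelQuermassintegrals (unitBall 3) (lensBody φ hS)
      (lensQuermassintegrals (lensArea p φ) p) := by
  intro ρ hρ
  have hp' : 4 * φ / Real.sin φ = p := by rw [← hp]; field_simp
  rw [volume_real_unitBall_add_smul_lensBody h0 h1 hS hρ, ← lensArea_eq h0 hS hp, hp']
  refine Eq.trans ?_ (Fin.sum_univ_four _).symm
  change _ = ((Nat.choose 3 0 : ℕ) : ℝ) * (4 / 3 * Real.pi) * ρ ^ 0 +
    ((Nat.choose 3 1 : ℕ) : ℝ) * ((Real.pi / 2 * p + 4 * Real.pi) / 3) * ρ ^ 1 +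
    ((Nat.choose 3 2 : ℕ) : ℝ) * ((2 * lensArea p φ + Real.pi * p + 4 * Real.pi) / 3) * ρ ^ 2 +
    ((Nat.choose 3 3 : ℕ) : ℝ) *
      (2 * lensArea p φ + Real.pi / 2 * p + 4 / 3 * Real.pi) * ρ ^ 3
  norm_num [Nat.choose]
  ring

end

end

theorem corollary1p5 :
    ∃ K : ConvexBody (Euc 3), (interior (K : Set (Euc 3))).Nonempty ∧
      ∃ (W : Fin 4 → ℝ) (r : ℝ),
        IsRelQuermassintegrals (unitBall 3) K W ∧
        IsRelInradius (unitBall 3) K r ∧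
        -- every root of the relative Steiner polynomial has real part less than `-r`
        (∀ s : ℂ, (steinerPolynomial W).IsRoot s → s.re < -r) ∧
        -- the body is the outer parallel body at distance one of the lens of perimeter `5.2`,
        -- and the Steiner polynomial, its roots and the inradius are as follows
        r = 1 / 2 ∧
        ∃ (φ : ℝ) (z : ℂ), 0 < φ ∧ φ < Real.pi / 2 ∧
          5.2 * Real.sin φ = 4 * φ ∧
          (K : Set (Euc 3)) = symmetricLens φ + Metric.closedBall (0 : Euc 3) 1 ∧
          steinerPolynomial W = lensCubic (lensArea 5.2 φ) 5.2 ∧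
          (steinerPolynomial W).roots = {-1, z, (starRingEnd ℂ) z} ∧
          |z.re - (-0.503393)| < 10 ^ (-6 : ℤ) ∧
          |z.im - 0.038442| < 10 ^ (-6 : ℤ) := by
  obtain ⟨φ, hφ1, hφ2, hφ⟩ := exists_lens_angle
  have h0 : 0 < φ := by linarith
  have h1 : φ < Real.pi / 2 := by linarith [Real.pi_gt_d2]
  have hS : 0 < Real.sin φ := by linarith
  obtain ⟨hA1, hA2⟩ := lensArea_bounds hφ1 hφ2 hφ
  obtain ⟨x, y, hx, hy, hsum, hprod⟩ := steiner_quadratic_bounds hA1 hA2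
  have ha : 0 < 2 * lensArea 5.2 φ + Real.pi / 2 * 5.2 + 4 / 3 * Real.pi := by
    linarith [Real.pi_pos]
  have hroots := roots_lensCubic ha.ne' hsum hprod
  have hpoly := steinerPolynomial_lensQuermassintegrals (lensArea 5.2 φ) 5.2
  -- The zero polynomial has the empty multiset of roots by convention.
  have hne : lensCubic (lensArea 5.2 φ) 5.2 ≠ 0 := by
    intro h
    simp [h] at hroots
  have hx' : x < -(1 / 2) := by
    have := (abs_lt.1 hx).2
    norm_num at this ⊢
    linarith
  refine ⟨lensBody φ hS, interior_lensBody_nonempty hS, lensQuermassintegrals (lensArea 5.2 φ) 5.2,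
    1 / 2, isRelQuermassintegrals_lensBody h0 h1 hS hφ, isRelInradius_lensBody hS, ?_, rfl, φ,
    ⟨x, y⟩, h0, h1, hφ, coe_lensBody hS, hpoly, hpoly ▸ hroots, hx, hy⟩
  intro s hs
  rw [hpoly, ← mem_roots hne, hroots] at hs
  simp only [Multiset.insert_eq_cons, Multiset.mem_cons, Multiset.mem_singleton] at hs
  rcases hs with rfl | rfl | rfl
  · norm_num
  · exact hx'
  · rw [Complex.conj_re]; exact hx'
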